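/- Let $\mathcal C$ be an abelian category. A class means a class of objects of $\mathcal C$; $\operatorname{Ext}^k$ denotes the (Yoneda) extension groups of $\mathcal C$, and dimensions take values in $\{0,1,2,\dots\}\cup\{\infty\}$, with $\inf\emptyset=\infty$ and $\sup\emptyset=0$. **Notation.** For classes $\mathcal Z,\mathcal T,\mathcal Y,\mathcal W$: - $\mathcal Z^{\perp}$ (resp. ${}^{\perp}\mathcal Z$) is the class of all $N$ with $\operatorname{Ext}^i(Z,N)=0$ (resp. $\operatorname{Ext}^i(N,Z)=0$) for all $i\ge 1$ and all $Z\in\mathcal Z$. - $\operatorname{pd}_{\mathcal T}(M)$ (resp. $\operatorname{id}_{\mathcal T}(M)$) is the least $n\ge 0$ such that $\operatorname{Ext}^k(M,T)=0$ (resp. $\operatorname{Ext}^k(T,M)=0$) for all $k>n$ and all $T\in\mathcal T$; $\operatorname{pd}_{\mathcal T}(\mathcal Z)=\sup_{Z\in\mathcal Z}\operatorname{pd}_{\mathcal T}(Z)$ and $\operatorname{id}_{\mathcal T}(\mathcal Z)=\sup_{Z\in\mathcal Z}\operatorname{id}_{\mathcal T}(Z)$. - A $\mathcal Y_{\mathcal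 W}$-coresolution of length $n$ of $M$ is an exact sequence $0\to M\xrightarrow{f_0}Y_0\xrightarrow{f_1}Y_1\to\cdots\xrightarrow{f_n}Y_n\to 0$ with $Y_n\in\mathcal W\cap\mathcal Y$, $Y_k\in\mathcal Y$ for $0\le k\le n-1$, and $\operatorname{Im}f_i\in\mathcal W$ for $1\le i\le n-1$. The least such $n$ is $\operatorname{coresdim}^{\mathcal W}_{\mathcal Y}(M)$, and $\operatorname{coresdim}^{\mathcal W}_{\mathcal Y}(\mathcal Z)=\sup_{Z\in\mathcal Z}\operatorname{coresdim}^{\mathcal W}_{\mathcal Y}(Z)$. The class of objects having a $\mathcal Y_{\mathcal W}$-coresolution of some finite length is $\mathcal Y_{\mathcal W}^{\vee}$, and $(\mathcal W,\mathcal Y)^{\vee}=\mathcal W\cap\mathcal Y_{\mathcal W}^{\vee}$. Dually, with exact sequences $0\to Y_n\to\cdots\to Y_0\to M\to 0$, one defines $\operatorname{resdim}^{\mathcal W}_{\mathcal Y}$, $\mathcal Y_{\mathcal W}^{\wedge}$ and $(\mathcal Y,\mathcal W)^{\wedge}=\mathcal Y_{\mathcal W}^{\wedge}\cap\mathcal W$.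 The symbol $\mathcal W$ is omitted when $\mathcal W=\mathcal C$. A pair $(\mathcal A,\mathcal B)$ is *$\mathcal X$-complete* if every $X\in\mathcal X$ admits exact sequences $0\to B\to A\to X\to 0$ and $0\to X\to B'\to A'\to 0$ with $A,A'\in\mathcal A\cap\mathcal X$ and $B,B'\in\mathcal B\cap\mathcal X$; it is *$\mathcal X$-hereditary* if $\operatorname{id}_{\mathcal A\cap\mathcal X}(\mathcal B\cap\mathcal X)=0$. **Theorem.** Let $\mathcal X,\mathcal A,\mathcal B$ be classes of objects of $\mathcal C$, each closed under extensions and direct summands, such that $(\mathcal A,\mathcal B)$ is $\mathcal X$-complete and $\mathcal X$-hereditary, and let $\omega=\mathcal A\cap\mathcal B\cap\mathcal X$. Then: (a) $\omega=(\mathcal A\cap\mathcal X)^{\perp}\cap\mathcal A\cap\mathcal X=\mathcal A\cap\mathcal X\cap\omega^{\wedge}=(\omega,\mathcal A\cap\mathcal X)^{\wedge}$. (a1) $$\begin{aligned}\operatorname{pd}_{\mathcal X}(\mathcal A\cap\mathcal X)&=\operatorname{pd}_{\mathcal A\cap\mathcal X}(\mathcal A\cap\mathcal X)=\operatorname{coresdim}_{\mathcal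 B\cap\mathcal X}(\mathcal A\cap\mathcal X)=\operatorname{coresdim}^{\mathcal X}_{\mathcal B}(\mathcal X)=\operatorname{coresdim}^{\mathcal X}_{\mathcal B}(\mathcal A\cap\mathcal X)\\&=\operatorname{coresdim}_{\omega}(\mathcal A\cap\mathcal X)=\operatorname{coresdim}^{\mathcal X}_{\mathcal B\cap\mathcal X}(\mathcal A\cap\mathcal X)=\operatorname{coresdim}^{\mathcal X}_{\mathcal B\cap\mathcal X}(\mathcal X).\end{aligned}$$ (a2) $\operatorname{pd}_{\mathcal A\cap\mathcal X}(\mathcal A\cap\mathcal X)<\infty$ if and only if $\mathcal A\cap\mathcal X\subseteq\omega^{\vee}$ and $\operatorname{pd}_{\mathcal X}(\omega)<\infty$. Moreover, if $\operatorname{pd}_{\mathcal A\cap\mathcal X}(\mathcal A\cap\mathcal X)<\infty$, then $\mathcal X\subseteq(\mathcal X,\mathcal B)^{\vee}\subseteq(\mathcal B\cap\mathcal X)^{\vee}$ and $\operatorname{pd}_{\mathcal X}(\mathcal A\cap\mathcal X)=\operatorname{pd}_{\mathcal X}(\omega)$. (b) $\omega={}^{\perp}(\mathcal B\cap\mathcal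 X)\cap\mathcal B\cap\mathcal X=\mathcal B\cap\mathcal X\cap\omega^{\vee}=(\mathcal B\cap\mathcal X,\omega)^{\vee}$. (b1) $$\begin{aligned}\operatorname{id}_{\mathcal X}(\mathcal B\cap\mathcal X)&=\operatorname{id}_{\mathcal B\cap\mathcal X}(\mathcal B\cap\mathcal X)=\operatorname{resdim}_{\mathcal A\cap\mathcal X}(\mathcal B\cap\mathcal X)=\operatorname{resdim}^{\mathcal X}_{\mathcal A}(\mathcal X)=\operatorname{resdim}^{\mathcal X}_{\mathcal A}(\mathcal B\cap\mathcal X)\\&=\operatorname{resdim}_{\omega}(\mathcal B\cap\mathcal X)=\operatorname{resdim}^{\mathcal X}_{\mathcal A\cap\mathcal X}(\mathcal B\cap\mathcal X)=\operatorname{resdim}^{\mathcal X}_{\mathcal A\cap\mathcal X}(\mathcal X).\end{aligned}$$ (b2) $\operatorname{id}_{\mathcal B\cap\mathcal X}(\mathcal B\cap\mathcal X)<\infty$ if and only if $\mathcal B\cap\mathcal X\subseteq\omega^{\wedge}$ and $\operatorname{id}_{\mathcal X}(\omega)<\infty$. Moreover, if $\operatorname{id}_{\mathcal B\cap\mathcal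 X}(\mathcal B\cap\mathcal X)<\infty$, then $\mathcal X\subseteq(\mathcal A,\mathcal X)^{\wedge}\subseteq(\mathcal A\cap\mathcal X)^{\wedge}$ and $\operatorname{id}_{\mathcal X}(\mathcal B\cap\mathcal X)=\operatorname{id}_{\mathcal X}(\omega)$. -/

import Mathlib

open CategoryTheory CategoryTheory.Limits

universe v u

namespace RelHomAlg

variable {C : Type u} [Category.{v} C] [Abelian C]

/-- `Ext^k(M, N) = 0`. The Ext-groups of an arbitrary abelian category are formed here in the
universe `max u v`, in which they always exist. -/
def ExtVanishes (M N : C) (k : ℕ) : Prop :=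
  letI : HasExt.{max u v} C := HasExt.standard C
  Subsingleton (Abelian.Ext.{max u v} M N k)

/-- The class of all `N` such that `Ext^i(M, N) = 0` for all `M` in `𝒵` and all `i > 0`. -/
def rightPerp (𝒵 : ObjectProperty C) : ObjectProperty C :=
  fun N => ∀ i : ℕ, 0 < i → ∀ M : C, 𝒵 M → ExtVanishes M N i

/-- The class of all `M` such that `Ext^i(M, N) = 0` for all `N` in `𝒵` and all `i > 0`. -/
def leftPerp (𝒵 : ObjectProperty C) : ObjectProperty C :=
  fun M => ∀ i : ℕ, 0 < i → ∀ N : C, 𝒵 N → ExtVanishes M N i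

/-- The `𝒯`-projective dimension of `M`: the least natural number `n` such that
`Ext^k(M, T) = 0` for all `k > n` and all `T` in `𝒯`, and `⊤` if there is none. -/
noncomputable def pdObj (𝒯 : ObjectProperty C) (M : C) : ℕ∞ :=
  ⨅ (n : ℕ) (_ : ∀ k : ℕ, n < k → ∀ T : C, 𝒯 T → ExtVanishes M T k), (n : ℕ∞)

/-- The `𝒯`-injective dimension of `M`: the least natural number `n` such that
`Ext^k(T, M) = 0` for all `k > n` and all `T` in `𝒯`, and `⊤` if there is none. -/
noncomputable def idObj (𝒯 : ObjectProperty C) (M : C) : ℕ∞ :=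
  ⨅ (n : ℕ) (_ : ∀ k : ℕ, n < k → ∀ T : C, 𝒯 T → ExtVanishes T M k), (n : ℕ∞)

/-- The `𝒯`-projective dimension of the class `𝒵`. -/
noncomputable def projd (𝒯 𝒵 : ObjectProperty C) : ℕ∞ :=
  ⨆ (M : C) (_ : 𝒵 M), pdObj 𝒯 M

/-- The `𝒯`-injective dimension of the class `𝒵`. -/
noncomputable def injd (𝒯 𝒵 : ObjectProperty C) : ℕ∞ :=
  ⨆ (M : C) (_ : 𝒵 M), idObj 𝒯 M

/-- A `𝒴_𝒳`-coresolution of length `n` of `M`: an exact sequence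
`0 ⟶ M ⟶ Y₀ ⟶ Y₁ ⟶ ⋯ ⟶ Yₙ ⟶ 0` (continued by zero objects), with maps
`ι : M ⟶ Y₀` and `d i : Yᵢ ⟶ Yᵢ₊₁`, such that `Yₖ` is in `𝒴` for `k < n`, `Yₙ` is in
`𝒳 ∩ 𝒴` and the images of the maps `Yᵢ ⟶ Yᵢ₊₁` are in `𝒳` whenever `i + 1 < n`. -/
structure Coresolution (𝒴 𝒳 : ObjectProperty C) (M : C) (n : ℕ) where
  obj : ℕ → C
  ι : M ⟶ obj 0
  d : ∀ i : ℕ, obj i ⟶ obj (i + 1)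
  mono_ι : Mono ι
  ι_d : ι ≫ d 0 = 0
  d_d : ∀ i : ℕ, d i ≫ d (i + 1) = 0
  exact_zero : (ShortComplex.mk ι (d 0) ι_d).Exact
  exact_succ : ∀ i : ℕ, (ShortComplex.mk (d i) (d (i + 1)) (d_d i)).Exact
  isZero_obj : ∀ i : ℕ, n < i → IsZero (obj i)
  obj_mem : ∀ k : ℕ, k < n → 𝒴 (obj k)
  last_mem : (𝒳 ⊓ 𝒴) (obj n)
  image_mem : ∀ i : ℕ, i + 1 < n → 𝒳 (image (d i))

/-- A `𝒴_𝒳`-resolution of length `n` of `M`: an exact sequence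
`0 ⟶ Yₙ ⟶ ⋯ ⟶ Y₁ ⟶ Y₀ ⟶ M ⟶ 0` (continued by zero objects), with maps
`π : Y₀ ⟶ M` and `d i : Yᵢ₊₁ ⟶ Yᵢ`, such that `Yₖ` is in `𝒴` for `k < n`, `Yₙ` is in
`𝒳 ∩ 𝒴` and the images of the maps `Yᵢ₊₁ ⟶ Yᵢ` are in `𝒳` whenever `i + 1 < n`. -/
structure Resolution (𝒴 𝒳 : ObjectProperty C) (M : C) (n : ℕ) where
  obj : ℕ → C
  π : obj 0 ⟶ M
  d : ∀ i : ℕ, obj (i + 1) ⟶ obj i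
  epi_π : Epi π
  d_π : d 0 ≫ π = 0
  d_d : ∀ i : ℕ, d (i + 1) ≫ d i = 0
  exact_zero : (ShortComplex.mk (d 0) π d_π).Exact
  exact_succ : ∀ i : ℕ, (ShortComplex.mk (d (i + 1)) (d i) (d_d i)).Exact
  isZero_obj : ∀ i : ℕ, n < i → IsZero (obj i)
  obj_mem : ∀ k : ℕ, k < n → 𝒴 (obj k)
  last_mem : (𝒳 ⊓ 𝒴) (obj n)
  image_mem : ∀ i : ℕ, i + 1 < n → 𝒳 (image (d i))

/-- The `𝒴_𝒳`-coresolution dimension of `M`. -/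
noncomputable def coresdimObj (𝒴 𝒳 : ObjectProperty C) (M : C) : ℕ∞ :=
  ⨅ (n : ℕ) (_ : Nonempty (Coresolution 𝒴 𝒳 M n)), (n : ℕ∞)

/-- The `𝒴_𝒳`-resolution dimension of `M`. -/
noncomputable def resdimObj (𝒴 𝒳 : ObjectProperty C) (M : C) : ℕ∞ :=
  ⨅ (n : ℕ) (_ : Nonempty (Resolution 𝒴 𝒳 M n)), (n : ℕ∞)

/-- `coresdimRel 𝒴 𝒳 𝒵` is the `𝒴_𝒳`-coresolution dimension of the class `𝒵`. -/
noncomputable def coresdimRel (𝒴 𝒳 𝒵 : ObjectProperty C) : ℕ∞ :=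
  ⨆ (M : C) (_ : 𝒵 M), coresdimObj 𝒴 𝒳 M

/-- `resdimRel 𝒴 𝒳 𝒵` is the `𝒴_𝒳`-resolution dimension of the class `𝒵`. -/
noncomputable def resdimRel (𝒴 𝒳 𝒵 : ObjectProperty C) : ℕ∞ :=
  ⨆ (M : C) (_ : 𝒵 M), resdimObj 𝒴 𝒳 M

/-- The absolute `𝒴`-coresolution dimension of the class `𝒵`. -/
noncomputable def coresdim (𝒴 𝒵 : ObjectProperty C) : ℕ∞ := coresdimRel 𝒴 ⊤ 𝒵

/-- The absolute `𝒴`-resolution dimension of the class `𝒵`. -/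
noncomputable def resdim (𝒴 𝒵 : ObjectProperty C) : ℕ∞ := resdimRel 𝒴 ⊤ 𝒵

/-- The class of the objects with a finite `𝒴_𝒳`-coresolution. -/
def veeRel (𝒴 𝒳 : ObjectProperty C) : ObjectProperty C :=
  fun M => ∃ n : ℕ, Nonempty (Coresolution 𝒴 𝒳 M n)

/-- The class of the objects with a finite `𝒴_𝒳`-resolution. -/
def wedgeRel (𝒴 𝒳 : ObjectProperty C) : ObjectProperty C :=
  fun M => ∃ n : ℕ, Nonempty (Resolution 𝒴 𝒳 M n)

/-- The class `𝒴^∨`. -/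
def vee (𝒴 : ObjectProperty C) : ObjectProperty C := veeRel 𝒴 ⊤

/-- The class `𝒴^∧`. -/
def wedge (𝒴 : ObjectProperty C) : ObjectProperty C := wedgeRel 𝒴 ⊤

/-- The class `(𝒳, 𝒴)^∨ = 𝒳 ∩ 𝒴_𝒳^∨`. -/
def pairVee (𝒳 𝒴 : ObjectProperty C) : ObjectProperty C := 𝒳 ⊓ veeRel 𝒴 𝒳

/-- The class `(𝒴, 𝒳)^∧ = 𝒴_𝒳^∧ ∩ 𝒳`. -/
def pairWedge (𝒴 𝒳 : ObjectProperty C) : ObjectProperty C := wedgeRel 𝒴 𝒳 ⊓ 𝒳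

/-- Every `M` in `𝒳` admits an exact sequence `0 ⟶ B ⟶ A ⟶ M ⟶ 0` with `A` in `𝒜 ∩ 𝒳` and
`B` in `ℬ ∩ 𝒳`. -/
def LeftComplete (𝒳 𝒜 ℬ : ObjectProperty C) : Prop :=
  ∀ M : C, 𝒳 M → ∃ (A B : C) (f : B ⟶ A) (g : A ⟶ M) (w : f ≫ g = 0),
    (ShortComplex.mk f g w).ShortExact ∧ (𝒜 ⊓ 𝒳) A ∧ (ℬ ⊓ 𝒳) B

/-- Every `M` in `𝒳` admits an exact sequence `0 ⟶ M ⟶ B ⟶ A ⟶ 0` with `A` in `𝒜 ∩ 𝒳` and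
`B` in `ℬ ∩ 𝒳`. -/
def RightComplete (𝒳 𝒜 ℬ : ObjectProperty C) : Prop :=
  ∀ M : C, 𝒳 M → ∃ (A B : C) (f : M ⟶ B) (g : B ⟶ A) (w : f ≫ g = 0),
    (ShortComplex.mk f g w).ShortExact ∧ (𝒜 ⊓ 𝒳) A ∧ (ℬ ⊓ 𝒳) B

/-- The pair `(𝒜, ℬ)` is `𝒳`-complete. -/
def IsComplete (𝒳 𝒜 ℬ : ObjectProperty C) : Prop :=
  LeftComplete 𝒳 𝒜 ℬ ∧ RightComplete 𝒳 𝒜 ℬ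

/-- The pair `(𝒜, ℬ)` is `𝒳`-hereditary. -/
def IsHereditary (𝒳 𝒜 ℬ : ObjectProperty C) : Prop :=
  injd (𝒜 ⊓ 𝒳) (ℬ ⊓ 𝒳) = 0

/-- `𝒵` is closed under direct summands: every direct summand (up to isomorphism) of an object
of `𝒵` is in `𝒵`. -/
def ClosedUnderSummands (𝒵 : ObjectProperty C) : Prop :=
  ∀ M N Z : C, 𝒵 Z → Nonempty (Z ≅ M ⊞ N) → 𝒵 M

end RelHomAlg

open scoped ZeroObject

namespace RelHomAlg

variable {C : Type u} [Category.{v} C] [Abelian C]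

/-! ### Vanishing of extension groups along short exact sequences -/

/-! After replacing 𝒜 and ℬ by their intersections with 𝒳, the pair consists of subclasses of 𝒳 with
Ext of positive degree vanishing from 𝒜 to ℬ, and ω is 𝒜 ∩ ℬ. Completeness and summand closure make
this orthogonality sharp: if M in 𝒳 satisfies Ext¹(𝒜, M) = 0, the sequence 0 ⟶ M ⟶ B ⟶ A ⟶ 0 splits,
so M is in ℬ (`mem_right_of_extVanishes`); dually for 𝒜. The descriptions of ω reduce to this test.

The dimension equalities form a sandwich. Dimension shifting along a ℬ-coresolution of length n
kills Ext^k(𝒜, M) for k > n, so every coresolution dimension in question is at least pd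
(`projd_le_coresdimRel`). Conversely, iterating completeness n times on M gives a cosyzygy with no
higher Ext from 𝒜, hence in ℬ (`nonempty_coresolution`). Its cokernels lie in 𝒜, so the terms stay
in any extension-closed class between 𝒜 and 𝒳 containing M: the choice 𝒳 gives terms in ℬ ∩ 𝒳, the
choice 𝒜 gives terms in ω.

For finiteness, a finite ω-coresolution cannot raise projective dimension, whatever its length
(`Coresolution.left_extVanishes`). -/

theorem ExtVanishes.of_forall_eq_zero {M N : C} {k : ℕ}
    (h : letI : HasExt.{max u v} C := HasExt.standard C
      ∀ x : Abelian.Ext.{max u v} M N k, x = 0) : ExtVanishes M N k :=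
  let : HasExt.{max u v} C := HasExt.standard C
  subsingleton_of_forall_eq 0 h

theorem ExtVanishes.fst_of_snd_of_trd {S : ShortComplex C} (hS : S.ShortExact) {T : C} {k : ℕ}
    (h₂ : ExtVanishes T S.X₂ (k + 1)) (h₃ : ExtVanishes T S.X₃ k) :
    ExtVanishes T S.X₁ (k + 1) := by
  let : HasExt.{max u v} C := HasExt.standard C
  refine .of_forall_eq_zero fun x => ?_
  obtain ⟨y, rfl⟩ := Abelian.Ext.covariant_sequence_exact₁ _ hS x (h₂.elim _ _) rfl
  rw [h₃.elim y 0, Abelian.Ext.zero_comp]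

theorem ExtVanishes.trd_of_fst_of_snd {S : ShortComplex C} (hS : S.ShortExact) {T : C} {k : ℕ}
    (h₁ : ExtVanishes T S.X₁ (k + 1)) (h₂ : ExtVanishes T S.X₂ k) :
    ExtVanishes T S.X₃ k := by
  let : HasExt.{max u v} C := HasExt.standard C
  refine .of_forall_eq_zero fun x => ?_
  obtain ⟨y, rfl⟩ := Abelian.Ext.covariant_sequence_exact₃ _ hS x rfl (h₁.elim _ _)
  rw [h₂.elim y 0, Abelian.Ext.zero_comp]

theorem ExtVanishes.left_fst_of_snd_of_trd {S : ShortComplex C} (hS : S.ShortExact) {T : C}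
    {k : ℕ} (h₂ : ExtVanishes S.X₂ T k) (h₃ : ExtVanishes S.X₃ T (k + 1)) :
    ExtVanishes S.X₁ T k := by
  let : HasExt.{max u v} C := HasExt.standard C
  refine .of_forall_eq_zero fun x => ?_
  obtain ⟨y, rfl⟩ :=
    Abelian.Ext.contravariant_sequence_exact₁ hS _ x (add_comm 1 k) (h₃.elim _ _)
  rw [h₂.elim y 0, Abelian.Ext.comp_zero]

theorem ExtVanishes.left_trd_of_fst_of_snd {S : ShortComplex C} (hS : S.ShortExact) {T : C}
    {k : ℕ} (h₁ : ExtVanishes S.X₁ T k) (h₂ : ExtVanishes S.X₂ T (k + 1)) :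
    ExtVanishes S.X₃ T (k + 1) := by
  let : HasExt.{max u v} C := HasExt.standard C
  refine .of_forall_eq_zero fun x => ?_
  obtain ⟨y, rfl⟩ :=
    Abelian.Ext.contravariant_sequence_exact₃ hS _ x (h₂.elim _ _) (add_comm 1 k)
  rw [h₁.elim y 0, Abelian.Ext.comp_zero]

/-- The obstruction to lifting the identity of `S.X₃` along `S.g` lies in Ext¹(`S.X₃`, `S.X₁`); a
lift is a section. -/
theorem ExtVanishes.nonempty_iso_biprod {S : ShortComplex C} (hS : S.ShortExact)
    (h : ExtVanishes S.X₃ S.X₁ 1) : Nonempty (S.X₂ ≅ S.X₁ ⊞ S.X₃) := by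
  let : HasExt.{max u v} C := HasExt.standard C
  obtain ⟨y, hy⟩ := Abelian.Ext.covariant_sequence_exact₃ _ hS (Abelian.Ext.mk₀ (𝟙 S.X₃))
    (zero_add 1) (h.elim _ _)
  obtain ⟨s, rfl⟩ := Abelian.Ext.homEquiv₀.symm.surjective y
  have hs : s ≫ S.g = 𝟙 _ := Abelian.Ext.homEquiv₀.symm.injective (by simpa using hy)
  exact ⟨(ShortComplex.Splitting.ofExactOfSection S hS.exact s hs hS.mono_f).isoBinaryBiproduct⟩

/-! ### Closure under isomorphisms -/

theorem ClosedUnderSummands.isClosedUnderIsomorphisms {𝒵 : ObjectProperty C}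
    (h : ClosedUnderSummands 𝒵) : 𝒵.IsClosedUnderIsomorphisms where
  of_iso e hX := h _ 0 _ hX ⟨e ≪≫ isoBiprodZero (isZero_zero C)⟩

/-! ### Peeling off the first term of a (co)resolution -/

section

variable {𝒴 𝒳 : ObjectProperty C}

namespace Coresolution

/-- The coresolution of length `0` of an object. -/
noncomputable def ofMem {M : C} (hM : (𝒳 ⊓ 𝒴) M) : Coresolution 𝒴 𝒳 M 0 where
  obj | 0 => M | _ + 1 => 0
  ι := 𝟙 M
  d _ := 0
  mono_ι := inferInstance
  ι_d := comp_zero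
  d_d _ := comp_zero
  exact_zero := ShortComplex.exact_iff_epi _ rfl |>.2 inferInstance
  exact_succ _ := ShortComplex.exact_of_isZero_X₂ _ (isZero_zero C)
  isZero_obj
    | _ + 1, _ => isZero_zero C
  obj_mem _ h := absurd h (Nat.not_lt_zero _)
  last_mem := hM
  image_mem _ h := absurd h (Nat.not_lt_zero _)

/-- Splicing a short exact sequence `0 ⟶ M ⟶ Y ⟶ N ⟶ 0` with a coresolution of `N`. -/
def cons [𝒳.IsClosedUnderIsomorphisms] {M Y N : C} {f : M ⟶ Y} {g : Y ⟶ N} {w : f ≫ g = 0}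
    (hS : (ShortComplex.mk f g w).ShortExact) (hY : 𝒴 Y) (hN : 𝒳 N) {n : ℕ}
    (R : Coresolution 𝒴 𝒳 N n) : Coresolution 𝒴 𝒳 M (n + 1) where
  obj | 0 => Y | i + 1 => R.obj i
  ι := f
  d | 0 => g ≫ R.ι | i + 1 => R.d i
  mono_ι := hS.mono_f
  ι_d := by rw [reassoc_of% w, zero_comp]
  d_d
    | 0 => by simp [R.ι_d]
    | i + 1 => R.d_d i
  exact_zero := by
    have := R.mono_ι
    -- Composing `g` with the monomorphism `R.ι` does not change its kernel.
    let φ : ShortComplex.mk f g w ⟶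
        ShortComplex.mk f (g ≫ R.ι) (by rw [reassoc_of% w, zero_comp]) :=
      { τ₁ := 𝟙 _, τ₂ := 𝟙 _, τ₃ := R.ι }
    exact (ShortComplex.exact_iff_of_epi_of_isIso_of_mono φ).1 hS.exact
  exact_succ
    | 0 => by
      have : Epi g := hS.epi_g
      let φ : ShortComplex.mk (g ≫ R.ι) (R.d 0) (by simp [R.ι_d]) ⟶
          ShortComplex.mk R.ι (R.d 0) R.ι_d :=
        { τ₁ := g, τ₂ := 𝟙 _, τ₃ := 𝟙 _ }
      exact (ShortComplex.exact_iff_of_epi_of_isIso_of_mono φ).2 R.exact_zero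
    | i + 1 => R.exact_succ i
  isZero_obj
    | i + 1, h => R.isZero_obj i (Nat.lt_of_succ_lt_succ h)
  obj_mem
    | 0, _ => hY
    | k + 1, h => R.obj_mem k (Nat.lt_of_succ_lt_succ h)
  last_mem := R.last_mem
  image_mem
    | 0, _ => by
      have : Epi g := hS.epi_g
      have := R.mono_ι
      have := strongEpi_of_epi g
      exact 𝒳.prop_of_iso (image.isoStrongEpiMono g R.ι rfl) hN
    | i + 1, h => R.image_mem i (Nat.lt_of_succ_lt_succ h)

/-- The coresolution of the first cosyzygy. -/
noncomputable def tail {M : C} {n : ℕ} (R : Coresolution 𝒴 𝒳 M (n + 1)) :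
    Coresolution 𝒴 𝒳 (image (R.d 0)) n where
  obj i := R.obj (i + 1)
  ι := image.ι (R.d 0)
  d i := R.d (i + 1)
  mono_ι := inferInstance
  ι_d := by
    rw [← cancel_epi (factorThruImage (R.d 0)), image.fac_assoc, R.d_d, comp_zero]
  d_d i := R.d_d (i + 1)
  exact_zero := by
    have w : image.ι (R.d 0) ≫ R.d 1 = 0 := by
      rw [← cancel_epi (factorThruImage (R.d 0)), image.fac_assoc, R.d_d, comp_zero]
    let φ : ShortComplex.mk (R.d 0) (R.d 1) (R.d_d 0) ⟶
        ShortComplex.mk (image.ι (R.d 0)) (R.d 1) w :=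
      { τ₁ := factorThruImage (R.d 0), τ₂ := 𝟙 _, τ₃ := 𝟙 _ }
    exact (ShortComplex.exact_iff_of_epi_of_isIso_of_mono φ).1 (R.exact_succ 0)
  exact_succ i := R.exact_succ (i + 1)
  isZero_obj i h := R.isZero_obj (i + 1) (Nat.succ_lt_succ h)
  obj_mem k h := R.obj_mem (k + 1) (Nat.succ_lt_succ h)
  last_mem := R.last_mem
  image_mem i h := R.image_mem (i + 1) (Nat.succ_lt_succ h)

theorem mem [𝒴.IsClosedUnderIsomorphisms] [𝒳.IsClosedUnderIsomorphisms] {M : C}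
    (R : Coresolution 𝒴 𝒳 M 0) : (𝒳 ⊓ 𝒴) M := by
  have := R.mono_ι
  have : Epi R.ι := R.exact_zero.epi_f ((R.isZero_obj 1 Nat.one_pos).eq_of_tgt _ _)
  have := isIso_of_mono_of_epi R.ι
  exact (𝒳 ⊓ 𝒴).prop_of_iso (asIso R.ι).symm R.last_mem

theorem shortExact {M : C} {n : ℕ} (R : Coresolution 𝒴 𝒳 M n) :
    ∃ w : R.ι ≫ factorThruImage (R.d 0) = 0,
      (ShortComplex.mk R.ι (factorThruImage (R.d 0)) w).ShortExact := by
  have w : R.ι ≫ factorThruImage (R.d 0) = 0 := by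
    rw [← cancel_mono (image.ι (R.d 0)), Category.assoc, image.fac, R.ι_d, zero_comp]
  let φ : ShortComplex.mk R.ι (factorThruImage (R.d 0)) w ⟶ ShortComplex.mk R.ι (R.d 0) R.ι_d :=
    { τ₁ := 𝟙 _, τ₂ := 𝟙 _, τ₃ := image.ι (R.d 0) }
  have := R.mono_ι
  exact ⟨w, ⟨(ShortComplex.exact_iff_of_epi_of_isIso_of_mono φ).2 R.exact_zero⟩⟩

end Coresolution

/-- This recursive form supports the inductions on length that build new (co)resolutions. -/
theorem nonempty_coresolution_succ_iff [𝒴.IsClosedUnderIsomorphisms]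
    [𝒳.IsClosedUnderIsomorphisms] {M : C} {n : ℕ} :
    Nonempty (Coresolution 𝒴 𝒳 M (n + 1)) ↔
      ∃ (Y N : C) (f : M ⟶ Y) (g : Y ⟶ N) (w : f ≫ g = 0),
        (ShortComplex.mk f g w).ShortExact ∧ 𝒴 Y ∧ 𝒳 N ∧ Nonempty (Coresolution 𝒴 𝒳 N n) := by
  constructor
  · rintro ⟨R⟩
    obtain ⟨w, hS⟩ := R.shortExact
    refine ⟨_, _, _, _, w, hS, R.obj_mem 0 n.succ_pos, ?_, ⟨R.tail⟩⟩
    -- In length one the image condition is empty; the cosyzygy is then isomorphic to the last term,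
    -- which lies in 𝒳 by `last_mem`.
    cases n with
    | zero => exact R.tail.mem.1
    | succ n => exact R.image_mem 0 (by omega)
  · rintro ⟨Y, N, f, g, w, hS, hY, hN, ⟨R⟩⟩
    exact ⟨R.cons hS hY hN⟩

namespace Resolution

/-- The resolution of length `0` of an object. -/
noncomputable def ofMem {M : C} (hM : (𝒳 ⊓ 𝒴) M) : Resolution 𝒴 𝒳 M 0 where
  obj | 0 => M | _ + 1 => 0
  π := 𝟙 M
  d _ := 0
  epi_π := inferInstance
  d_π := zero_comp
  d_d _ := comp_zero
  exact_zero := ShortComplex.exact_iff_mono _ rfl |>.2 inferInstance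
  exact_succ _ := ShortComplex.exact_of_isZero_X₂ _ (isZero_zero C)
  isZero_obj
    | _ + 1, _ => isZero_zero C
  obj_mem _ h := absurd h (Nat.not_lt_zero _)
  last_mem := hM
  image_mem _ h := absurd h (Nat.not_lt_zero _)

/-- Splicing a short exact sequence `0 ⟶ N ⟶ Y ⟶ M ⟶ 0` with a resolution of `N`. -/
def cons [𝒳.IsClosedUnderIsomorphisms] {M Y N : C} {f : N ⟶ Y} {g : Y ⟶ M} {w : f ≫ g = 0}
    (hS : (ShortComplex.mk f g w).ShortExact) (hY : 𝒴 Y) (hN : 𝒳 N) {n : ℕ}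
    (R : Resolution 𝒴 𝒳 N n) : Resolution 𝒴 𝒳 M (n + 1) where
  obj | 0 => Y | i + 1 => R.obj i
  π := g
  d | 0 => R.π ≫ f | i + 1 => R.d i
  epi_π := hS.epi_g
  d_π := by rw [Category.assoc, w, comp_zero]
  d_d
    | 0 => by simp [reassoc_of% R.d_π]
    | i + 1 => R.d_d i
  exact_zero := by
    have := R.epi_π
    let φ : ShortComplex.mk (R.π ≫ f) g (by rw [Category.assoc, w, comp_zero]) ⟶
        ShortComplex.mk f g w :=
      { τ₁ := R.π, τ₂ := 𝟙 _, τ₃ := 𝟙 _ }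
    exact (ShortComplex.exact_iff_of_epi_of_isIso_of_mono φ).2 hS.exact
  exact_succ
    | 0 => by
      have : Mono f := hS.mono_f
      let φ : ShortComplex.mk (R.d 0) R.π R.d_π ⟶
          ShortComplex.mk (R.d 0) (R.π ≫ f) (by simp [reassoc_of% R.d_π]) :=
        { τ₁ := 𝟙 _, τ₂ := 𝟙 _, τ₃ := f }
      exact (ShortComplex.exact_iff_of_epi_of_isIso_of_mono φ).1 R.exact_zero
    | i + 1 => R.exact_succ i
  isZero_obj
    | i + 1, h => R.isZero_obj i (Nat.lt_of_succ_lt_succ h)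
  obj_mem
    | 0, _ => hY
    | k + 1, h => R.obj_mem k (Nat.lt_of_succ_lt_succ h)
  last_mem := R.last_mem
  image_mem
    | 0, _ => by
      have : Mono f := hS.mono_f
      have := R.epi_π
      have := strongEpi_of_epi R.π
      exact 𝒳.prop_of_iso (image.isoStrongEpiMono R.π f rfl) hN
    | i + 1, h => R.image_mem i (Nat.lt_of_succ_lt_succ h)

/-- The resolution of the first syzygy. -/
noncomputable def tail {M : C} {n : ℕ} (R : Resolution 𝒴 𝒳 M (n + 1)) :
    Resolution 𝒴 𝒳 (image (R.d 0)) n where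
  obj i := R.obj (i + 1)
  π := factorThruImage (R.d 0)
  d i := R.d (i + 1)
  epi_π := inferInstance
  d_π := by
    rw [← cancel_mono (image.ι (R.d 0)), Category.assoc, image.fac, R.d_d, zero_comp]
  d_d i := R.d_d (i + 1)
  exact_zero := by
    have w : R.d 1 ≫ factorThruImage (R.d 0) = 0 := by
      rw [← cancel_mono (image.ι (R.d 0)), Category.assoc, image.fac, R.d_d, zero_comp]
    let φ : ShortComplex.mk (R.d 1) (factorThruImage (R.d 0)) w ⟶
        ShortComplex.mk (R.d 1) (R.d 0) (R.d_d 0) :=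
      { τ₁ := 𝟙 _, τ₂ := 𝟙 _, τ₃ := image.ι (R.d 0) }
    exact (ShortComplex.exact_iff_of_epi_of_isIso_of_mono φ).2 (R.exact_succ 0)
  exact_succ i := R.exact_succ (i + 1)
  isZero_obj i h := R.isZero_obj (i + 1) (Nat.succ_lt_succ h)
  obj_mem k h := R.obj_mem (k + 1) (Nat.succ_lt_succ h)
  last_mem := R.last_mem
  image_mem i h := R.image_mem (i + 1) (Nat.succ_lt_succ h)

theorem mem [𝒴.IsClosedUnderIsomorphisms] [𝒳.IsClosedUnderIsomorphisms] {M : C}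
    (R : Resolution 𝒴 𝒳 M 0) : (𝒳 ⊓ 𝒴) M := by
  have := R.epi_π
  have : Mono R.π := R.exact_zero.mono_g ((R.isZero_obj 1 Nat.one_pos).eq_of_src _ _)
  have := isIso_of_mono_of_epi R.π
  exact (𝒳 ⊓ 𝒴).prop_of_iso (asIso R.π) R.last_mem

theorem shortExact {M : C} {n : ℕ} (R : Resolution 𝒴 𝒳 M n) :
    ∃ w : image.ι (R.d 0) ≫ R.π = 0, (ShortComplex.mk (image.ι (R.d 0)) R.π w).ShortExact := by
  have w : image.ι (R.d 0) ≫ R.π = 0 := by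
    rw [← cancel_epi (factorThruImage (R.d 0)), image.fac_assoc, R.d_π, comp_zero]
  let φ : ShortComplex.mk (R.d 0) R.π R.d_π ⟶ ShortComplex.mk (image.ι (R.d 0)) R.π w :=
    { τ₁ := factorThruImage (R.d 0), τ₂ := 𝟙 _, τ₃ := 𝟙 _ }
  have := R.epi_π
  exact ⟨w, ⟨(ShortComplex.exact_iff_of_epi_of_isIso_of_mono φ).1 R.exact_zero⟩⟩

end Resolution

theorem nonempty_resolution_succ_iff [𝒴.IsClosedUnderIsomorphisms]
    [𝒳.IsClosedUnderIsomorphisms] {M : C} {n : ℕ} :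
    Nonempty (Resolution 𝒴 𝒳 M (n + 1)) ↔
      ∃ (Y N : C) (f : N ⟶ Y) (g : Y ⟶ M) (w : f ≫ g = 0),
        (ShortComplex.mk f g w).ShortExact ∧ 𝒴 Y ∧ 𝒳 N ∧ Nonempty (Resolution 𝒴 𝒳 N n) := by
  constructor
  · rintro ⟨R⟩
    obtain ⟨w, hS⟩ := R.shortExact
    refine ⟨_, _, _, _, w, hS, R.obj_mem 0 n.succ_pos, ?_, ⟨R.tail⟩⟩
    cases n with
    | zero => exact R.tail.mem.1
    | succ n => exact R.image_mem 0 (by omega)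
  · rintro ⟨Y, N, f, g, w, hS, hY, hN, ⟨R⟩⟩
    exact ⟨R.cons hS hY hN⟩

end

/-! ### Bounds for the homological dimensions -/

theorem iInf_natCast_le_natCast_iff {P : ℕ → Prop} {n : ℕ} :
    (⨅ (m : ℕ) (_ : P m), (m : ℕ∞)) ≤ n ↔ ∃ m ≤ n, P m := by
  constructor
  · intro h
    by_contra! hP
    have : ((n + 1 : ℕ) : ℕ∞) ≤ ⨅ (m : ℕ) (_ : P m), (m : ℕ∞) :=
      le_iInf₂ fun m hm => Nat.cast_le.2 (by by_contra hlt; exact hP m (by omega) hm)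
    have := Nat.cast_le.1 (this.trans h)
    omega
  · rintro ⟨m, hm, hP⟩
    exact (iInf₂_le m hP).trans (Nat.cast_le.2 hm)

/-- Comparing finite upper bounds suffices, so infinite dimensions need no separate treatment. -/
theorem le_of_forall_le_natCast {a b : ℕ∞} (h : ∀ n : ℕ, b ≤ n → a ≤ n) : a ≤ b := by
  induction b using ENat.recTopCoe with
  | top => exact le_top
  | coe n => exact h n le_rfl

theorem projd_le_iff {𝒯 𝒵 : ObjectProperty C} {n : ℕ} :
    projd 𝒯 𝒵 ≤ n ↔ ∀ M, 𝒵 M → ∀ k, n < k → ∀ T, 𝒯 T → ExtVanishes M T k := by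
  simp only [projd, iSup_le_iff, pdObj, iInf_natCast_le_natCast_iff]
  exact forall₂_congr fun M _ => ⟨fun ⟨m, hm, h⟩ k hk => h k (hm.trans_lt hk),
    fun h => ⟨n, le_rfl, h⟩⟩

theorem injd_le_iff {𝒯 𝒵 : ObjectProperty C} {n : ℕ} :
    injd 𝒯 𝒵 ≤ n ↔ ∀ M, 𝒵 M → ∀ k, n < k → ∀ T, 𝒯 T → ExtVanishes T M k := by
  simp only [injd, iSup_le_iff, idObj, iInf_natCast_le_natCast_iff]
  exact forall₂_congr fun M _ => ⟨fun ⟨m, hm, h⟩ k hk => h k (hm.trans_lt hk),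
    fun h => ⟨n, le_rfl, h⟩⟩

theorem coresdimRel_le_iff {𝒴 𝒳 𝒵 : ObjectProperty C} {n : ℕ} :
    coresdimRel 𝒴 𝒳 𝒵 ≤ n ↔ ∀ M, 𝒵 M → ∃ m ≤ n, Nonempty (Coresolution 𝒴 𝒳 M m) := by
  simp only [coresdimRel, iSup_le_iff, coresdimObj, iInf_natCast_le_natCast_iff]

theorem resdimRel_le_iff {𝒴 𝒳 𝒵 : ObjectProperty C} {n : ℕ} :
    resdimRel 𝒴 𝒳 𝒵 ≤ n ↔ ∀ M, 𝒵 M → ∃ m ≤ n, Nonempty (Resolution 𝒴 𝒳 M m) := by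
  simp only [resdimRel, iSup_le_iff, resdimObj, iInf_natCast_le_natCast_iff]

/-! ### Monotonicity in the classes, and the symmetry between pd and id -/

section

variable {𝒴 𝒳 𝒴' 𝒳' 𝒵 𝒵' : ObjectProperty C}

/-- Enlarging the classes of a coresolution. -/
def Coresolution.ofLE (hY : 𝒴 ≤ 𝒴') (hX : 𝒳 ≤ 𝒳') {M : C} {n : ℕ}
    (R : Coresolution 𝒴 𝒳 M n) : Coresolution 𝒴' 𝒳' M n :=
  { R with
    obj_mem := fun k hk => hY _ (R.obj_mem k hk)
    last_mem := ⟨hX _ R.last_mem.1, hY _ R.last_mem.2⟩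
    image_mem := fun i hi => hX _ (R.image_mem i hi) }

/-- Enlarging the classes of a resolution. -/
def Resolution.ofLE (hY : 𝒴 ≤ 𝒴') (hX : 𝒳 ≤ 𝒳') {M : C} {n : ℕ}
    (R : Resolution 𝒴 𝒳 M n) : Resolution 𝒴' 𝒳' M n :=
  { R with
    obj_mem := fun k hk => hY _ (R.obj_mem k hk)
    last_mem := ⟨hX _ R.last_mem.1, hY _ R.last_mem.2⟩
    image_mem := fun i hi => hX _ (R.image_mem i hi) }

theorem coresdimRel_le_coresdimRel (hY : 𝒴 ≤ 𝒴') (hX : 𝒳 ≤ 𝒳') (hZ : 𝒵 ≤ 𝒵') :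
    coresdimRel 𝒴' 𝒳' 𝒵 ≤ coresdimRel 𝒴 𝒳 𝒵' :=
  le_of_forall_le_natCast fun _ hn => coresdimRel_le_iff.2 fun M hM =>
    let ⟨m, hm, ⟨R⟩⟩ := coresdimRel_le_iff.1 hn M (hZ _ hM)
    ⟨m, hm, ⟨R.ofLE hY hX⟩⟩

theorem resdimRel_le_resdimRel (hY : 𝒴 ≤ 𝒴') (hX : 𝒳 ≤ 𝒳') (hZ : 𝒵 ≤ 𝒵') :
    resdimRel 𝒴' 𝒳' 𝒵 ≤ resdimRel 𝒴 𝒳 𝒵' :=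
  le_of_forall_le_natCast fun _ hn => resdimRel_le_iff.2 fun M hM =>
    let ⟨m, hm, ⟨R⟩⟩ := resdimRel_le_iff.1 hn M (hZ _ hM)
    ⟨m, hm, ⟨R.ofLE hY hX⟩⟩

theorem projd_mono {𝒯 𝒯' : ObjectProperty C} (hT : 𝒯 ≤ 𝒯') (hZ : 𝒵 ≤ 𝒵') :
    projd 𝒯 𝒵 ≤ projd 𝒯' 𝒵' :=
  le_of_forall_le_natCast fun _ hn => projd_le_iff.2 fun M hM k hk T h =>
    projd_le_iff.1 hn M (hZ _ hM) k hk T (hT _ h)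

/-- Both sides measure the vanishing of the same groups Ext^k(T, M), with T in 𝒯 and M in 𝒵. -/
theorem injd_eq_projd (𝒯 𝒵 : ObjectProperty C) : injd 𝒯 𝒵 = projd 𝒵 𝒯 :=
  le_antisymm
    (le_of_forall_le_natCast fun _ hn => injd_le_iff.2 fun M hM k hk T hT =>
      projd_le_iff.1 hn T hT k hk M hM)
    (le_of_forall_le_natCast fun _ hn => projd_le_iff.2 fun M hM k hk T hT =>
      injd_le_iff.1 hn T hT k hk M hM)

theorem le_veeRel_of_lt_top (hf : coresdimRel 𝒴 𝒳 𝒵 < ⊤) :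
    𝒵 ≤ veeRel 𝒴 𝒳 := by
  obtain ⟨n, hn⟩ := ENat.ne_top_iff_exists.1 hf.ne
  intro M hM
  obtain ⟨m, -, hR⟩ := coresdimRel_le_iff.1 hn.ge M hM
  exact ⟨m, hR⟩

theorem le_wedgeRel_of_lt_top (hf : resdimRel 𝒴 𝒳 𝒵 < ⊤) :
    𝒵 ≤ wedgeRel 𝒴 𝒳 := by
  obtain ⟨n, hn⟩ := ENat.ne_top_iff_exists.1 hf.ne
  intro M hM
  obtain ⟨m, -, hR⟩ := resdimRel_le_iff.1 hn.ge M hM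
  exact ⟨m, hR⟩

/-! ### Dimension shifting along (co)resolutions -/

variable [𝒴.IsClosedUnderIsomorphisms] [𝒳.IsClosedUnderIsomorphisms]

theorem Coresolution.extVanishes {T : C} (hT : ∀ Y, 𝒴 Y → ∀ k, 0 < k → ExtVanishes T Y k)
    {n : ℕ} {M : C} (R : Coresolution 𝒴 𝒳 M n) {k : ℕ} (hk : n < k) : ExtVanishes T M k := by
  induction n generalizing M k with
  | zero => exact hT M R.mem.2 k hk
  | succ n ih =>
    obtain ⟨k, rfl⟩ := Nat.exists_eq_add_one_of_ne_zero (Nat.ne_zero_of_lt hk)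
    obtain ⟨w, hS⟩ := R.shortExact
    exact .fst_of_snd_of_trd hS (hT _ (R.obj_mem 0 n.succ_pos) _ k.succ_pos)
      (ih R.tail (Nat.lt_of_succ_lt_succ hk))

/-- Ext^k(M, T) sits between Ext^k(Y, T) and Ext^(k+1)(N, T), where N is the cosyzygy. The degree
only rises along the induction, so the bound `m` does not depend on the length `n`. -/
theorem Coresolution.left_extVanishes {T : C} {m : ℕ}
    (hT : ∀ Y, 𝒴 Y → ∀ k, m < k → ExtVanishes Y T k)
    {n : ℕ} {M : C} (R : Coresolution 𝒴 𝒳 M n) {k : ℕ} (hk : m < k) : ExtVanishes M T k := by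
  induction n generalizing M k with
  | zero => exact hT M R.mem.2 k hk
  | succ n ih =>
    obtain ⟨w, hS⟩ := R.shortExact
    exact .left_fst_of_snd_of_trd hS (hT _ (R.obj_mem 0 n.succ_pos) _ hk)
      (ih R.tail (hk.trans k.lt_succ_self))

theorem Resolution.extVanishes {T : C} (hT : ∀ Y, 𝒴 Y → ∀ k, 0 < k → ExtVanishes Y T k)
    {n : ℕ} {M : C} (R : Resolution 𝒴 𝒳 M n) {k : ℕ} (hk : n < k) : ExtVanishes M T k := by
  induction n generalizing M k with
  | zero => exact hT M R.mem.2 k hk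
  | succ n ih =>
    obtain ⟨k, rfl⟩ := Nat.exists_eq_add_one_of_ne_zero (Nat.ne_zero_of_lt hk)
    obtain ⟨w, hS⟩ := R.shortExact
    exact .left_trd_of_fst_of_snd hS (ih R.tail (Nat.lt_of_succ_lt_succ hk))
      (hT _ (R.obj_mem 0 n.succ_pos) _ k.succ_pos)

theorem Resolution.right_extVanishes {T : C} {m : ℕ}
    (hT : ∀ Y, 𝒴 Y → ∀ k, m < k → ExtVanishes T Y k)
    {n : ℕ} {M : C} (R : Resolution 𝒴 𝒳 M n) {k : ℕ} (hk : m < k) : ExtVanishes T M k := by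
  induction n generalizing M k with
  | zero => exact hT M R.mem.2 k hk
  | succ n ih =>
    obtain ⟨w, hS⟩ := R.shortExact
    exact .trd_of_fst_of_snd hS (ih R.tail (hk.trans k.lt_succ_self))
      (hT _ (R.obj_mem 0 n.succ_pos) _ hk)

/-- Each term is an extension of one cosyzygy by the preceding one, and these all lie in 𝒳 once M
does. -/
theorem Coresolution.nonempty_inf (hX : 𝒳.IsClosedUnderExtensions) {n : ℕ} {M : C}
    (hM : 𝒳 M) (R : Coresolution 𝒴 𝒳 M n) : Nonempty (Coresolution (𝒴 ⊓ 𝒳) 𝒳 M n) := by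
  induction n generalizing M with
  | zero => exact ⟨.ofMem ⟨hM, R.mem.2, hM⟩⟩
  | succ n ih =>
    obtain ⟨Y, N, f, g, w, hS, hY, hN, ⟨R'⟩⟩ := nonempty_coresolution_succ_iff.1 ⟨R⟩
    obtain ⟨R''⟩ := ih hN R'
    exact ⟨R''.cons hS ⟨hY, 𝒳.prop_X₂_of_shortExact hS hM hN⟩ hN⟩

theorem Resolution.nonempty_inf (hX : 𝒳.IsClosedUnderExtensions) {n : ℕ} {M : C}
    (hM : 𝒳 M) (R : Resolution 𝒴 𝒳 M n) : Nonempty (Resolution (𝒴 ⊓ 𝒳) 𝒳 M n) := by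
  induction n generalizing M with
  | zero => exact ⟨.ofMem ⟨hM, R.mem.2, hM⟩⟩
  | succ n ih =>
    obtain ⟨Y, N, f, g, w, hS, hY, hN, ⟨R'⟩⟩ := nonempty_resolution_succ_iff.1 ⟨R⟩
    obtain ⟨R''⟩ := ih hN R'
    exact ⟨R''.cons hS ⟨hY, 𝒳.prop_X₂_of_shortExact hS hN hM⟩ hN⟩

theorem coresdimRel_inf (hX : 𝒳.IsClosedUnderExtensions) (hZ : 𝒵 ≤ 𝒳) :
    coresdimRel (𝒴 ⊓ 𝒳) 𝒳 𝒵 = coresdimRel 𝒴 𝒳 𝒵 :=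
  le_antisymm
    (le_of_forall_le_natCast fun _ hn => coresdimRel_le_iff.2 fun M hM =>
      let ⟨m, hm, ⟨R⟩⟩ := coresdimRel_le_iff.1 hn M hM
      ⟨m, hm, R.nonempty_inf hX (hZ _ hM)⟩)
    (coresdimRel_le_coresdimRel inf_le_left le_rfl le_rfl)

theorem resdimRel_inf (hX : 𝒳.IsClosedUnderExtensions) (hZ : 𝒵 ≤ 𝒳) :
    resdimRel (𝒴 ⊓ 𝒳) 𝒳 𝒵 = resdimRel 𝒴 𝒳 𝒵 :=
  le_antisymm
    (le_of_forall_le_natCast fun _ hn => resdimRel_le_iff.2 fun M hM =>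
      let ⟨m, hm, ⟨R⟩⟩ := resdimRel_le_iff.1 hn M hM
      ⟨m, hm, R.nonempty_inf hX (hZ _ hM)⟩)
    (resdimRel_le_resdimRel inf_le_left le_rfl le_rfl)

end

/-! ### Reduction to a pair of subclasses of 𝒳 -/

/-- Subclasses `𝒜` and `ℬ` of `𝒳` forming a pair complete and hereditary relative to `𝒳`, all
three classes being closed under extensions and direct summands. -/
structure IsCompleteHereditaryPair (𝒳 𝒜 ℬ : ObjectProperty C) : Prop where
  left_le : 𝒜 ≤ 𝒳
  right_le : ℬ ≤ 𝒳
  isClosedUnderExtensions : 𝒳.IsClosedUnderExtensions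
  isClosedUnderExtensions_left : 𝒜.IsClosedUnderExtensions
  isClosedUnderExtensions_right : ℬ.IsClosedUnderExtensions
  closedUnderSummands : ClosedUnderSummands 𝒳
  closedUnderSummands_left : ClosedUnderSummands 𝒜
  closedUnderSummands_right : ClosedUnderSummands ℬ
  extVanishes : ∀ M, 𝒜 M → ∀ N, ℬ N → ∀ k, 0 < k → ExtVanishes M N k
  exists_left : ∀ M : C, 𝒳 M → ∃ (A B : C) (f : B ⟶ A) (g : A ⟶ M) (w : f ≫ g = 0),
    (ShortComplex.mk f g w).ShortExact ∧ 𝒜 A ∧ ℬ B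
  exists_right : ∀ M : C, 𝒳 M → ∃ (A B : C) (f : M ⟶ B) (g : B ⟶ A) (w : f ≫ g = 0),
    (ShortComplex.mk f g w).ShortExact ∧ 𝒜 A ∧ ℬ B

theorem ClosedUnderSummands.inf {𝒵 𝒲 : ObjectProperty C} (hZ : ClosedUnderSummands 𝒵)
    (hW : ClosedUnderSummands 𝒲) : ClosedUnderSummands (𝒵 ⊓ 𝒲) :=
  fun M N Z h e => ⟨hZ M N Z h.1 e, hW M N Z h.2 e⟩

theorem isClosedUnderExtensions_inf {𝒵 𝒲 : ObjectProperty C} (hZ : 𝒵.IsClosedUnderExtensions)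
    (hW : 𝒲.IsClosedUnderExtensions) : (𝒵 ⊓ 𝒲).IsClosedUnderExtensions where
  prop_X₂_of_shortExact hS h₁ h₃ :=
    ⟨𝒵.prop_X₂_of_shortExact hS h₁.1 h₃.1, 𝒲.prop_X₂_of_shortExact hS h₁.2 h₃.2⟩

theorem IsComplete.isCompleteHereditaryPair {𝒳 𝒜 ℬ : ObjectProperty C}
    (hc : IsComplete 𝒳 𝒜 ℬ) (hh : IsHereditary 𝒳 𝒜 ℬ)
    (hAext : 𝒜.IsClosedUnderExtensions) (hXext : 𝒳.IsClosedUnderExtensions)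
    (hBext : ℬ.IsClosedUnderExtensions) (hAsmd : ClosedUnderSummands 𝒜)
    (hXsmd : ClosedUnderSummands 𝒳) (hBsmd : ClosedUnderSummands ℬ) :
    IsCompleteHereditaryPair 𝒳 (𝒜 ⊓ 𝒳) (ℬ ⊓ 𝒳) where
  left_le := inf_le_right
  right_le := inf_le_right
  isClosedUnderExtensions := hXext
  isClosedUnderExtensions_left := isClosedUnderExtensions_inf hAext hXext
  isClosedUnderExtensions_right := isClosedUnderExtensions_inf hBext hXext
  closedUnderSummands := hXsmd
  closedUnderSummands_left := hAsmd.inf hXsmd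
  closedUnderSummands_right := hBsmd.inf hXsmd
  extVanishes M hM N hN k hk := (injd_le_iff (n := 0)).1 (by simpa using hh.le) N hN k hk M hM
  exists_left := hc.1
  exists_right := hc.2

/-! ### Membership tests and construction of (co)resolutions -/

namespace IsCompleteHereditaryPair

variable {𝒳 𝒜 ℬ 𝒵 : ObjectProperty C}

/-- The embedding of M into an object of ℬ with cokernel in 𝒜 splits, so M is a direct summand of
that object. -/
theorem mem_right_of_extVanishes (h : IsCompleteHereditaryPair 𝒳 𝒜 ℬ) {M : C} (hM : 𝒳 M)
    (hv : ∀ T, 𝒜 T → ExtVanishes T M 1) : ℬ M := by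
  obtain ⟨A, B, f, g, w, hS, hA, hB⟩ := h.exists_right M hM
  exact h.closedUnderSummands_right _ _ _ hB (ExtVanishes.nonempty_iso_biprod hS (hv A hA))

theorem mem_left_of_extVanishes (h : IsCompleteHereditaryPair 𝒳 𝒜 ℬ) {M : C} (hM : 𝒳 M)
    (hv : ∀ T, ℬ T → ExtVanishes M T 1) : 𝒜 M := by
  obtain ⟨A, B, f, g, w, hS, hA, hB⟩ := h.exists_left M hM
  exact h.closedUnderSummands_left _ _ _ hA
    -- Here M is the quotient, hence the second factor; summand closure is stated for the first.
    ((ExtVanishes.nonempty_iso_biprod hS (hv B hB)).map (· ≪≫ biprod.braiding _ _))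

/-- Passing to the cokernel A of M ⟶ B lowers the degree bound by one, since Ext^k(T, B) = 0 for k >
0. At bound zero the object itself lies in ℬ. The class 𝒵 is free so that it can be taken to be 𝒳 or
𝒜. -/
theorem nonempty_coresolution (h : IsCompleteHereditaryPair 𝒳 𝒜 ℬ)
    [𝒵.IsClosedUnderIsomorphisms] [𝒵.IsClosedUnderExtensions] (hA : 𝒜 ≤ 𝒵) (hX : 𝒵 ≤ 𝒳)
    {n : ℕ} {M : C} (hM : 𝒵 M) (hv : ∀ T, 𝒜 T → ∀ k, n < k → ExtVanishes T M k) :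
    Nonempty (Coresolution (ℬ ⊓ 𝒵) 𝒵 M n) := by
  induction n generalizing M with
  | zero =>
    exact ⟨.ofMem ⟨hM, h.mem_right_of_extVanishes (hX _ hM) fun T hT => hv T hT 1 one_pos, hM⟩⟩
  | succ n ih =>
    obtain ⟨A, B, f, g, w, hS, hA', hB⟩ := h.exists_right M (hX _ hM)
    obtain ⟨R⟩ := ih (hA _ hA') fun T hT k hk => .trd_of_fst_of_snd hS
      (hv T hT _ (Nat.succ_lt_succ hk)) (h.extVanishes T hT B hB k (Nat.zero_lt_of_lt hk))
    exact ⟨R.cons hS ⟨hB, 𝒵.prop_X₂_of_shortExact hS hM (hA _ hA')⟩ (hA _ hA')⟩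

theorem nonempty_resolution (h : IsCompleteHereditaryPair 𝒳 𝒜 ℬ)
    [𝒵.IsClosedUnderIsomorphisms] [𝒵.IsClosedUnderExtensions] (hB : ℬ ≤ 𝒵) (hX : 𝒵 ≤ 𝒳)
    {n : ℕ} {M : C} (hM : 𝒵 M) (hv : ∀ T, ℬ T → ∀ k, n < k → ExtVanishes M T k) :
    Nonempty (Resolution (𝒜 ⊓ 𝒵) 𝒵 M n) := by
  induction n generalizing M with
  | zero =>
    exact ⟨.ofMem ⟨hM, h.mem_left_of_extVanishes (hX _ hM) fun T hT => hv T hT 1 one_pos, hM⟩⟩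
  | succ n ih =>
    obtain ⟨A, B, f, g, w, hS, hA, hB'⟩ := h.exists_left M (hX _ hM)
    obtain ⟨R⟩ := ih (hB _ hB') fun T hT k hk => .left_fst_of_snd_of_trd hS
      (h.extVanishes A hA T hT k (Nat.zero_lt_of_lt hk)) (hv T hT _ (Nat.succ_lt_succ hk))
    exact ⟨R.cons hS ⟨hA, 𝒵.prop_X₂_of_shortExact hS (hB _ hB') hM⟩ (hB _ hB')⟩

theorem isClosedUnderIsomorphisms (h : IsCompleteHereditaryPair 𝒳 𝒜 ℬ) :
    𝒳.IsClosedUnderIsomorphisms ∧ 𝒜.IsClosedUnderIsomorphisms ∧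
      ℬ.IsClosedUnderIsomorphisms :=
  ⟨h.closedUnderSummands.isClosedUnderIsomorphisms,
    h.closedUnderSummands_left.isClosedUnderIsomorphisms,
    h.closedUnderSummands_right.isClosedUnderIsomorphisms⟩

/-! ### The core of the pair -/

theorem inf_eq_rightPerp (h : IsCompleteHereditaryPair 𝒳 𝒜 ℬ) :
    𝒜 ⊓ ℬ = rightPerp 𝒜 ⊓ 𝒜 :=
  le_antisymm (fun M hM => ⟨fun k hk T hT => h.extVanishes T hT M hM.2 k hk, hM.1⟩)
    fun _ hM => ⟨hM.2, h.mem_right_of_extVanishes (h.left_le _ hM.2) (hM.1 1 one_pos)⟩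

theorem inf_eq_leftPerp (h : IsCompleteHereditaryPair 𝒳 𝒜 ℬ) :
    𝒜 ⊓ ℬ = leftPerp ℬ ⊓ ℬ :=
  le_antisymm (fun M hM => ⟨fun k hk T hT => h.extVanishes M hM.1 T hT k hk, hM.2⟩)
    fun _ hM => ⟨h.mem_left_of_extVanishes (h.right_le _ hM.2) (hM.1 1 one_pos), hM.2⟩

/-- Positive Ext from 𝒜 vanishes on ℬ, hence on every object with a finite ω-resolution. The class 𝒵
covers both the absolute and the relative resolutions. -/
theorem inf_eq_inf_wedgeRel (h : IsCompleteHereditaryPair 𝒳 𝒜 ℬ)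
    [𝒵.IsClosedUnderIsomorphisms] (hZ : 𝒜 ≤ 𝒵) :
    𝒜 ⊓ ℬ = 𝒜 ⊓ wedgeRel (𝒜 ⊓ ℬ) 𝒵 := by
  obtain ⟨_, _, _⟩ := h.isClosedUnderIsomorphisms
  refine le_antisymm (fun M hM => ⟨hM.1, 0, ⟨.ofMem ⟨hZ _ hM.1, hM⟩⟩⟩) ?_
  rintro M ⟨hM, n, ⟨R⟩⟩
  exact ⟨hM, h.mem_right_of_extVanishes (h.left_le _ hM) fun T hT =>
    R.right_extVanishes (fun Y hY => h.extVanishes T hT Y hY.2) one_pos⟩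

theorem inf_eq_inf_veeRel (h : IsCompleteHereditaryPair 𝒳 𝒜 ℬ)
    [𝒵.IsClosedUnderIsomorphisms] (hZ : ℬ ≤ 𝒵) :
    𝒜 ⊓ ℬ = ℬ ⊓ veeRel (𝒜 ⊓ ℬ) 𝒵 := by
  obtain ⟨_, _, _⟩ := h.isClosedUnderIsomorphisms
  refine le_antisymm (fun M hM => ⟨hM.2, 0, ⟨.ofMem ⟨hZ _ hM.2, hM⟩⟩⟩) ?_
  rintro M ⟨hM, n, ⟨R⟩⟩
  exact ⟨h.mem_left_of_extVanishes (h.right_le _ hM) fun T hT =>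
    R.left_extVanishes (fun Y hY => h.extVanishes Y hY.1 T hT) one_pos, hM⟩

/-! ### Equality of the dimensions -/

/-- Any T in 𝒳 is a quotient of some A in 𝒜 by some B in ℬ, and Ext from 𝒜 does not see B in
positive degrees. -/
theorem projd_eq (h : IsCompleteHereditaryPair 𝒳 𝒜 ℬ) : projd 𝒳 𝒜 = projd 𝒜 𝒜 := by
  refine le_antisymm (le_of_forall_le_natCast fun n hn => projd_le_iff.2 fun M hM k hk T hT => ?_)
    (projd_mono h.left_le le_rfl)
  obtain ⟨A, B, f, g, w, hS, hA, hB⟩ := h.exists_left T hT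
  exact .trd_of_fst_of_snd hS (h.extVanishes M hM B hB _ k.succ_pos)
    (projd_le_iff.1 hn M hM k hk A hA)

theorem injd_eq (h : IsCompleteHereditaryPair 𝒳 𝒜 ℬ) : injd 𝒳 ℬ = injd ℬ ℬ := by
  rw [injd_eq_projd, injd_eq_projd]
  refine le_antisymm (le_of_forall_le_natCast fun n hn => projd_le_iff.2 fun M hM k hk T hT => ?_)
    (projd_mono le_rfl h.right_le)
  obtain ⟨A, B, f, g, w, hS, hA, hB⟩ := h.exists_right M hM
  exact .left_fst_of_snd_of_trd hS (projd_le_iff.1 hn B hB k hk T hT)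
    (h.extVanishes A hA T hT _ k.succ_pos)

theorem projd_le_coresdim (h : IsCompleteHereditaryPair 𝒳 𝒜 ℬ) :
    projd 𝒜 𝒜 ≤ coresdim ℬ 𝒜 := by
  obtain ⟨_, _, _⟩ := h.isClosedUnderIsomorphisms
  refine le_of_forall_le_natCast fun n hn => projd_le_iff.2 fun M hM k hk T hT => ?_
  obtain ⟨m, hm, ⟨R⟩⟩ := coresdimRel_le_iff.1 hn T hT
  exact R.extVanishes (h.extVanishes M hM) (hm.trans_lt hk)

theorem injd_le_resdim (h : IsCompleteHereditaryPair 𝒳 𝒜 ℬ) :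
    injd ℬ ℬ ≤ resdim 𝒜 ℬ := by
  obtain ⟨_, _, _⟩ := h.isClosedUnderIsomorphisms
  refine le_of_forall_le_natCast fun n hn => injd_le_iff.2 fun M hM k hk T hT => ?_
  obtain ⟨m, hm, ⟨R⟩⟩ := resdimRel_le_iff.1 hn T hT
  exact R.extVanishes (fun Y hY => h.extVanishes Y hY M hM) (hm.trans_lt hk)

theorem coresdimRel_le_projd (h : IsCompleteHereditaryPair 𝒳 𝒜 ℬ)
    (hZiso : 𝒵.IsClosedUnderIsomorphisms) (hZext : 𝒵.IsClosedUnderExtensions)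
    (hA : 𝒜 ≤ 𝒵) (hX : 𝒵 ≤ 𝒳) : coresdimRel (ℬ ⊓ 𝒵) 𝒵 𝒵 ≤ projd 𝒳 𝒜 :=
  le_of_forall_le_natCast fun n hn => coresdimRel_le_iff.2 fun M hM =>
    ⟨n, le_rfl, h.nonempty_coresolution hA hX hM fun T hT k hk =>
      projd_le_iff.1 hn T hT k hk M (hX _ hM)⟩

theorem resdimRel_le_injd (h : IsCompleteHereditaryPair 𝒳 𝒜 ℬ)
    (hZiso : 𝒵.IsClosedUnderIsomorphisms) (hZext : 𝒵.IsClosedUnderExtensions)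
    (hB : ℬ ≤ 𝒵) (hX : 𝒵 ≤ 𝒳) : resdimRel (𝒜 ⊓ 𝒵) 𝒵 𝒵 ≤ injd 𝒳 ℬ :=
  le_of_forall_le_natCast fun n hn => resdimRel_le_iff.2 fun M hM =>
    ⟨n, le_rfl, h.nonempty_resolution hB hX hM fun T hT k hk =>
      injd_le_iff.1 hn T hT k hk M (hX _ hM)⟩

/-- The common lower half of the sandwich: shrinking 𝒴, restricting the images or enlarging 𝒵 can
only increase the coresolution dimension. -/
theorem projd_le_coresdimRel (h : IsCompleteHereditaryPair 𝒳 𝒜 ℬ) {𝒴 𝒳' : ObjectProperty C}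
    (hY : 𝒴 ≤ ℬ) (hZ : 𝒜 ≤ 𝒵) : projd 𝒳 𝒜 ≤ coresdimRel 𝒴 𝒳' 𝒵 :=
  h.projd_eq.le.trans (h.projd_le_coresdim.trans (coresdimRel_le_coresdimRel hY le_top hZ))

theorem injd_le_resdimRel (h : IsCompleteHereditaryPair 𝒳 𝒜 ℬ) {𝒴 𝒳' : ObjectProperty C}
    (hY : 𝒴 ≤ 𝒜) (hZ : ℬ ≤ 𝒵) : injd 𝒳 ℬ ≤ resdimRel 𝒴 𝒳' 𝒵 :=
  h.injd_eq.le.trans (h.injd_le_resdim.trans (resdimRel_le_resdimRel hY le_top hZ))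

theorem projd_eq_coresdimRel (h : IsCompleteHereditaryPair 𝒳 𝒜 ℬ) (hA : 𝒜 ≤ 𝒵) (hX : 𝒵 ≤ 𝒳) :
    projd 𝒳 𝒜 = coresdimRel ℬ 𝒳 𝒵 := by
  refine le_antisymm (h.projd_le_coresdimRel le_rfl hA) ?_
  exact (coresdimRel_le_coresdimRel inf_le_left le_rfl hX).trans
    (h.coresdimRel_le_projd h.isClosedUnderIsomorphisms.1 h.isClosedUnderExtensions h.left_le
      le_rfl)

theorem injd_eq_resdimRel (h : IsCompleteHereditaryPair 𝒳 𝒜 ℬ) (hB : ℬ ≤ 𝒵) (hX : 𝒵 ≤ 𝒳) :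
    injd 𝒳 ℬ = resdimRel 𝒜 𝒳 𝒵 := by
  refine le_antisymm (h.injd_le_resdimRel le_rfl hB) ?_
  exact (resdimRel_le_resdimRel inf_le_left le_rfl hX).trans
    (h.resdimRel_le_injd h.isClosedUnderIsomorphisms.1 h.isClosedUnderExtensions h.right_le
      le_rfl)

/-- Starting in 𝒜, all cosyzygies stay in 𝒜, and so do the terms of the constructed coresolution. -/
theorem projd_eq_coresdim_inf (h : IsCompleteHereditaryPair 𝒳 𝒜 ℬ) :
    projd 𝒳 𝒜 = coresdim (𝒜 ⊓ ℬ) 𝒜 := by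
  refine le_antisymm (h.projd_le_coresdimRel inf_le_right le_rfl) ?_
  exact (coresdimRel_le_coresdimRel (inf_comm _ _).le le_top le_rfl).trans
    (h.coresdimRel_le_projd h.isClosedUnderIsomorphisms.2.1 h.isClosedUnderExtensions_left le_rfl
      h.left_le)

theorem injd_eq_resdim_inf (h : IsCompleteHereditaryPair 𝒳 𝒜 ℬ) :
    injd 𝒳 ℬ = resdim (𝒜 ⊓ ℬ) ℬ := by
  refine le_antisymm (h.injd_le_resdimRel inf_le_left le_rfl) ?_
  exact (resdimRel_le_resdimRel le_rfl le_top le_rfl).trans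
    (h.resdimRel_le_injd h.isClosedUnderIsomorphisms.2.2 h.isClosedUnderExtensions_right le_rfl
      h.right_le)

theorem projd_eq_coresdim (h : IsCompleteHereditaryPair 𝒳 𝒜 ℬ) :
    projd 𝒳 𝒜 = coresdim ℬ 𝒜 :=
  le_antisymm (h.projd_le_coresdimRel le_rfl le_rfl)
    (h.projd_eq_coresdim_inf.ge.trans' (coresdimRel_le_coresdimRel inf_le_right le_rfl le_rfl))

theorem injd_eq_resdim (h : IsCompleteHereditaryPair 𝒳 𝒜 ℬ) :
    injd 𝒳 ℬ = resdim 𝒜 ℬ :=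
  le_antisymm (h.injd_le_resdimRel le_rfl le_rfl)
    (h.injd_eq_resdim_inf.ge.trans' (resdimRel_le_resdimRel inf_le_left le_rfl le_rfl))

/-! ### Finiteness -/

/-- No uniform bound on the lengths of the ω-coresolutions is needed, because the length does not
enter `Coresolution.left_extVanishes`. -/
theorem projd_eq_projd_inf (h : IsCompleteHereditaryPair 𝒳 𝒜 ℬ) (hv : 𝒜 ≤ vee (𝒜 ⊓ ℬ)) :
    projd 𝒳 𝒜 = projd 𝒳 (𝒜 ⊓ ℬ) := by
  obtain ⟨_, _, _⟩ := h.isClosedUnderIsomorphisms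
  refine le_antisymm (le_of_forall_le_natCast fun n hn => projd_le_iff.2 fun M hM k hk T hT => ?_)
    (projd_mono le_rfl inf_le_left)
  obtain ⟨m, ⟨R⟩⟩ := hv M hM
  exact R.left_extVanishes (fun Y hY k hk => projd_le_iff.1 hn Y hY k hk T hT) hk

theorem injd_eq_injd_inf (h : IsCompleteHereditaryPair 𝒳 𝒜 ℬ) (hv : ℬ ≤ wedge (𝒜 ⊓ ℬ)) :
    injd 𝒳 ℬ = injd 𝒳 (𝒜 ⊓ ℬ) := by
  obtain ⟨_, _, _⟩ := h.isClosedUnderIsomorphisms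
  rw [injd_eq_projd, injd_eq_projd]
  refine le_antisymm (le_of_forall_le_natCast fun n hn => projd_le_iff.2 fun M hM k hk T hT => ?_)
    (projd_mono inf_le_right le_rfl)
  obtain ⟨m, ⟨R⟩⟩ := hv T hT
  exact R.right_extVanishes (fun Y hY k hk => projd_le_iff.1 hn M hM k hk Y hY) hk

theorem le_vee_of_lt_top (h : IsCompleteHereditaryPair 𝒳 𝒜 ℬ) (hf : projd 𝒜 𝒜 < ⊤) :
    𝒜 ≤ vee (𝒜 ⊓ ℬ) :=
  le_veeRel_of_lt_top (h.projd_eq_coresdim_inf.symm.trans h.projd_eq |>.trans_lt hf)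

theorem le_wedge_of_lt_top (h : IsCompleteHereditaryPair 𝒳 𝒜 ℬ) (hf : injd ℬ ℬ < ⊤) :
    ℬ ≤ wedge (𝒜 ⊓ ℬ) :=
  le_wedgeRel_of_lt_top (h.injd_eq_resdim_inf.symm.trans h.injd_eq |>.trans_lt hf)

theorem projd_lt_top_iff (h : IsCompleteHereditaryPair 𝒳 𝒜 ℬ) :
    projd 𝒜 𝒜 < ⊤ ↔ 𝒜 ≤ vee (𝒜 ⊓ ℬ) ∧ projd 𝒳 (𝒜 ⊓ ℬ) < ⊤ := by
  refine ⟨fun hf => ⟨h.le_vee_of_lt_top hf, ?_⟩, fun ⟨hv, hf⟩ => ?_⟩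
  · rwa [← h.projd_eq_projd_inf (h.le_vee_of_lt_top hf), h.projd_eq]
  · rwa [← h.projd_eq, h.projd_eq_projd_inf hv]

theorem injd_lt_top_iff (h : IsCompleteHereditaryPair 𝒳 𝒜 ℬ) :
    injd ℬ ℬ < ⊤ ↔ ℬ ≤ wedge (𝒜 ⊓ ℬ) ∧ injd 𝒳 (𝒜 ⊓ ℬ) < ⊤ := by
  refine ⟨fun hf => ⟨h.le_wedge_of_lt_top hf, ?_⟩, fun ⟨hv, hf⟩ => ?_⟩
  · rwa [← h.injd_eq_injd_inf (h.le_wedge_of_lt_top hf), h.injd_eq]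
  · rwa [← h.injd_eq, h.injd_eq_injd_inf hv]

end IsCompleteHereditaryPair

/-! ### From relative to absolute (co)resolutions, and the theorem -/

theorem pairVee_le_vee_inf {𝒳 ℬ : ObjectProperty C} [ℬ.IsClosedUnderIsomorphisms]
    [𝒳.IsClosedUnderIsomorphisms] (hX : 𝒳.IsClosedUnderExtensions) :
    pairVee 𝒳 ℬ ≤ vee (ℬ ⊓ 𝒳) := fun _ ⟨hM, n, ⟨R⟩⟩ =>
  ⟨n, (R.nonempty_inf hX hM).map (·.ofLE le_rfl le_top)⟩

theorem pairWedge_le_wedge_inf {𝒳 𝒜 : ObjectProperty C} [𝒜.IsClosedUnderIsomorphisms]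
    [𝒳.IsClosedUnderIsomorphisms] (hX : 𝒳.IsClosedUnderExtensions) :
    pairWedge 𝒜 𝒳 ≤ wedge (𝒜 ⊓ 𝒳) := fun _ ⟨⟨n, ⟨R⟩⟩, hM⟩ =>
  ⟨n, (R.nonempty_inf hX hM).map (·.ofLE le_rfl le_top)⟩

end RelHomAlg

open RelHomAlg in
theorem mainTheorem3 {C : Type u} [Category.{v} C] [Abelian C]
    (𝒳 𝒜 ℬ ω : ObjectProperty C)
    (hcomplete : RelHomAlg.IsComplete 𝒳 𝒜 ℬ)
    (hhereditary : RelHomAlg.IsHereditary 𝒳 𝒜 ℬ)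
    (hAext : 𝒜.IsClosedUnderExtensions)
    (hXext : 𝒳.IsClosedUnderExtensions)
    (hBext : ℬ.IsClosedUnderExtensions)
    (hAsmd : RelHomAlg.ClosedUnderSummands 𝒜)
    (hXsmd : RelHomAlg.ClosedUnderSummands 𝒳)
    (hBsmd : RelHomAlg.ClosedUnderSummands ℬ)
    (hω : ω = 𝒜 ⊓ ℬ ⊓ 𝒳) :
    -- (a)
    (ω = RelHomAlg.rightPerp (𝒜 ⊓ 𝒳) ⊓ 𝒜 ⊓ 𝒳 ∧
      ω = 𝒜 ⊓ 𝒳 ⊓ RelHomAlg.wedge ω ∧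
      ω = RelHomAlg.pairWedge ω (𝒜 ⊓ 𝒳)) ∧
    -- (a1)
    (RelHomAlg.projd 𝒳 (𝒜 ⊓ 𝒳) = RelHomAlg.projd (𝒜 ⊓ 𝒳) (𝒜 ⊓ 𝒳) ∧
      RelHomAlg.projd 𝒳 (𝒜 ⊓ 𝒳) = RelHomAlg.coresdim (ℬ ⊓ 𝒳) (𝒜 ⊓ 𝒳) ∧
      RelHomAlg.projd 𝒳 (𝒜 ⊓ 𝒳) = RelHomAlg.coresdimRel ℬ 𝒳 𝒳 ∧
      RelHomAlg.projd 𝒳 (𝒜 ⊓ 𝒳) = RelHomAlg.coresdimRel ℬ 𝒳 (𝒜 ⊓ 𝒳) ∧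
      RelHomAlg.projd 𝒳 (𝒜 ⊓ 𝒳) = RelHomAlg.coresdim ω (𝒜 ⊓ 𝒳) ∧
      RelHomAlg.projd 𝒳 (𝒜 ⊓ 𝒳) = RelHomAlg.coresdimRel (ℬ ⊓ 𝒳) 𝒳 (𝒜 ⊓ 𝒳) ∧
      RelHomAlg.projd 𝒳 (𝒜 ⊓ 𝒳) = RelHomAlg.coresdimRel (ℬ ⊓ 𝒳) 𝒳 𝒳) ∧
    -- (a2)
    ((RelHomAlg.projd (𝒜 ⊓ 𝒳) (𝒜 ⊓ 𝒳) < ⊤ ↔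
        𝒜 ⊓ 𝒳 ≤ RelHomAlg.vee ω ∧ RelHomAlg.projd 𝒳 ω < ⊤) ∧
      (RelHomAlg.projd (𝒜 ⊓ 𝒳) (𝒜 ⊓ 𝒳) < ⊤ →
        𝒳 ≤ RelHomAlg.pairVee 𝒳 ℬ ∧
        RelHomAlg.pairVee 𝒳 ℬ ≤ RelHomAlg.vee (ℬ ⊓ 𝒳) ∧
        RelHomAlg.projd 𝒳 (𝒜 ⊓ 𝒳) = RelHomAlg.projd 𝒳 ω)) ∧
    -- (b)
    (ω = RelHomAlg.leftPerp (ℬ ⊓ 𝒳) ⊓ ℬ ⊓ 𝒳 ∧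
      ω = ℬ ⊓ 𝒳 ⊓ RelHomAlg.vee ω ∧
      ω = RelHomAlg.pairVee (ℬ ⊓ 𝒳) ω) ∧
    -- (b1)
    (RelHomAlg.injd 𝒳 (ℬ ⊓ 𝒳) = RelHomAlg.injd (ℬ ⊓ 𝒳) (ℬ ⊓ 𝒳) ∧
      RelHomAlg.injd 𝒳 (ℬ ⊓ 𝒳) = RelHomAlg.resdim (𝒜 ⊓ 𝒳) (ℬ ⊓ 𝒳) ∧
      RelHomAlg.injd 𝒳 (ℬ ⊓ 𝒳) = RelHomAlg.resdimRel 𝒜 𝒳 𝒳 ∧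
      RelHomAlg.injd 𝒳 (ℬ ⊓ 𝒳) = RelHomAlg.resdimRel 𝒜 𝒳 (ℬ ⊓ 𝒳) ∧
      RelHomAlg.injd 𝒳 (ℬ ⊓ 𝒳) = RelHomAlg.resdim ω (ℬ ⊓ 𝒳) ∧
      RelHomAlg.injd 𝒳 (ℬ ⊓ 𝒳) = RelHomAlg.resdimRel (𝒜 ⊓ 𝒳) 𝒳 (ℬ ⊓ 𝒳) ∧
      RelHomAlg.injd 𝒳 (ℬ ⊓ 𝒳) = RelHomAlg.resdimRel (𝒜 ⊓ 𝒳) 𝒳 𝒳) ∧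
    -- (b2)
    ((RelHomAlg.injd (ℬ ⊓ 𝒳) (ℬ ⊓ 𝒳) < ⊤ ↔
        ℬ ⊓ 𝒳 ≤ RelHomAlg.wedge ω ∧ RelHomAlg.injd 𝒳 ω < ⊤) ∧
      (RelHomAlg.injd (ℬ ⊓ 𝒳) (ℬ ⊓ 𝒳) < ⊤ →
        𝒳 ≤ RelHomAlg.pairWedge 𝒜 𝒳 ∧
        RelHomAlg.pairWedge 𝒜 𝒳 ≤ RelHomAlg.wedge (𝒜 ⊓ 𝒳) ∧
        RelHomAlg.injd 𝒳 (ℬ ⊓ 𝒳) = RelHomAlg.injd 𝒳 ω)) := by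
  have h := hcomplete.isCompleteHereditaryPair hhereditary hAext hXext hBext hAsmd hXsmd hBsmd
  have := hAsmd.isClosedUnderIsomorphisms
  have := hBsmd.isClosedUnderIsomorphisms
  obtain ⟨_, _, _⟩ := h.isClosedUnderIsomorphisms
  -- In this form ω is the core of the reduced pair (𝒜 ∩ 𝒳, ℬ ∩ 𝒳).
  obtain rfl : ω = (𝒜 ⊓ 𝒳) ⊓ (ℬ ⊓ 𝒳) := hω.trans (inf_inf_distrib_right _ _ _)
  have hA : 𝒜 ⊓ 𝒳 ≤ 𝒳 := inf_le_right
  have hB : ℬ ⊓ 𝒳 ≤ 𝒳 := inf_le_right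
  refine ⟨⟨?_, h.inf_eq_inf_wedgeRel le_top, ?_⟩,
    ⟨h.projd_eq, h.projd_eq_coresdim, ?_, ?_, h.projd_eq_coresdim_inf,
      h.projd_eq_coresdimRel le_rfl hA, h.projd_eq_coresdimRel hA le_rfl⟩,
    ⟨h.projd_lt_top_iff, fun hf => ⟨?_, pairVee_le_vee_inf hXext,
      h.projd_eq_projd_inf (h.le_vee_of_lt_top hf)⟩⟩,
    ⟨?_, h.inf_eq_inf_veeRel le_top, h.inf_eq_inf_veeRel le_rfl⟩,
    ⟨h.injd_eq, h.injd_eq_resdim, ?_, ?_, h.injd_eq_resdim_inf,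
      h.injd_eq_resdimRel le_rfl hB, h.injd_eq_resdimRel hB le_rfl⟩,
    ⟨h.injd_lt_top_iff, fun hf => ⟨?_, pairWedge_le_wedge_inf hXext,
      h.injd_eq_injd_inf (h.le_wedge_of_lt_top hf)⟩⟩⟩
  · exact h.inf_eq_rightPerp.trans (inf_assoc _ _ _).symm
  · exact (h.inf_eq_inf_wedgeRel le_rfl).trans (inf_comm _ _)
  -- Terms in ℬ can be taken in ℬ ∩ 𝒳, since images in 𝒳 force the terms into 𝒳.
  · rw [← coresdimRel_inf hXext le_rfl]
    exact h.projd_eq_coresdimRel hA le_rfl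
  · rw [← coresdimRel_inf hXext hA]
    exact h.projd_eq_coresdimRel le_rfl hA
  · refine le_inf le_rfl (le_veeRel_of_lt_top ?_)
    rwa [← coresdimRel_inf hXext le_rfl, ← h.projd_eq_coresdimRel hA le_rfl, h.projd_eq]
  · exact h.inf_eq_leftPerp.trans (inf_assoc _ _ _).symm
  · rw [← resdimRel_inf hXext le_rfl]
    exact h.injd_eq_resdimRel hB le_rfl
  · rw [← resdimRel_inf hXext hB]
    exact h.injd_eq_resdimRel le_rfl hB
  · refine le_inf (le_wedgeRel_of_lt_top ?_) le_rfl
    rwa [← resdimRel_inf hXext le_rfl, ← h.injd_eq_resdimRel hB le_rfl, h.injd_eq]
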